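/- Let the forwarding-plane state $S_X(t)\in\{0,1\}$, $t\ge 0$, be a binary alternating process: it starts in state $0$ and stays in the states $0$ and $1$ alternately for the positive durations $Y_1,Z_1,Y_2,Z_2,\dots$, where the down-periods $Y_m$ are i.i.d. with finite mean $\theta_X$, the up-periods $Z_m$ are i.i.d. with finite mean $\tau_X$, and every $Y_m$ is independent of every $Z_n$. Every change of state may or may not be reported (immediately) to the control plane by one update packet; a reported change sets the perceived state $\hat S_X$ to the current state, an unreported one leaves $\hat S_X$ as it was. An update policy reports each change $0\to1$ with a fixed probability $U^1$ and each change $1\to0$ with a fixed probability $U^2$, and $\hat S_X(0)=1$ with a fixed probability $\rho_0$; all these random choices are independent of each other and of $S_X$. Let $$D_1=\lim_{w\to\infty}\frac1w\int_0^w \Pr\big(S_X(t)=1,\hat S_X(t)=0\big)\,dt,\qquad D_2=\lim_{w\to\infty}\frac1w\int_0^w \Pr\big(S_X(t)=0,\hat S_X(t)=1\big)\,dt$$ be the false-negative and false-positive distortions of a policy, and let its update rate be $\lim_{w\to\infty}\frac1w\,E[\text{number of update packets sent in }[0,w]]$. Let $\epsilon_1,\epsilon_2\ge 0$; the distortion criterion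 is $D_1\le\epsilon_1$ and $D_2\le\epsilon_2$. For every policy all these limits exist, and the following holds. (i) If $\frac{\epsilon_2}{1-\epsilon_2}<\frac{\theta_X}{\tau_X}<\frac{1-\epsilon_1}{\epsilon_1}$ (the last quotient being $+\infty$ for $\epsilon_1=0$) and $\epsilon_2\tau_X+\epsilon_1\theta_X<\frac{\tau_X\theta_X}{\tau_X+\theta_X}$, then every policy that satisfies the distortion criterion has update rate $$R_X(\epsilon_1,\epsilon_2)\ \ge\ \frac{1}{\tau_X+\theta_X}\left(2-\frac{\epsilon_1\frac{\theta_X}{\tau_X}}{\frac{\theta_X}{\tau_X+\theta_X}-\epsilon_2}-\frac{\epsilon_2\frac{\tau_X}{\theta_X}}{\frac{\tau_X}{\tau_X+\theta_X}-\epsilon_1}\right),$$ and some policy that satisfies the criterion attains equality, so that the right-hand side is the minimum update rate. (ii) Otherwise, there is a policy that satisfies the distortion criterion and almost surely never sends an update. -/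

import Mathlib

open MeasureTheory ProbabilityTheory Filter Topology

/-- The durations of the down periods `Y 0, Y 1, …` (state `0`) and of the up periods
`Z 0, Z 1, …` (state `1`) of a binary alternating process: positive, i.i.d. down periods with
finite mean `θ`, i.i.d. up periods with finite mean `τ`, and every down period independent of
every up period. -/
structure IsAlternatingProcess {Ω : Type*} [MeasurableSpace Ω] (μ : Measure Ω)
    (Y Z : ℕ → Ω → ℝ) (τ θ : ℝ) : Prop where
  measurable_down : ∀ m, Measurable (Y m)
  measurable_up : ∀ m, Measurable (Z m)
  down_pos : ∀ m, ∀ᵐ ω ∂μ, 0 < Y m ω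
  up_pos : ∀ m, ∀ᵐ ω ∂μ, 0 < Z m ω
  indep_down : iIndepFun Y μ
  indep_up : iIndepFun Z μ
  indep_down_up : ∀ m n, IndepFun (Y m) (Z n) μ
  identDistrib_down : ∀ m, IdentDistrib (Y m) (Y 0) μ μ
  identDistrib_up : ∀ m, IdentDistrib (Z m) (Z 0) μ μ
  integrable_down : Integrable (Y 0) μ
  integrable_up : Integrable (Z 0) μ
  mean_down : ∫ ω, Y 0 ω ∂μ = θ
  mean_up : ∫ ω, Z 0 ω ∂μ = τ

section Forwarding

variable {Ω : Type*} (Y Z : ℕ → Ω → ℝ)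

/-- The length of the `k`-th period, `k = 0, 1, 2, …`. The process starts in state `0`, so that
the even periods are the down periods and the odd ones the up periods. -/
def periodLength (k : ℕ) (ω : Ω) : ℝ :=
  if Even k then Y (k / 2) ω else Z (k / 2) ω

/-- The time of the `k`-th change of state, `k = 0, 1, 2, …`; it ends the `k`-th period. Changes
with even index are of type I (`0 → 1`), those with odd index are of type II (`1 → 0`). -/
noncomputable def changeTime (k : ℕ) (ω : Ω) : ℝ :=
  ∑ i ∈ Finset.range (k + 1), periodLength Y Z i ω

/-- The number of changes of state during `[0, t]`. -/
noncomputable def changeCount (t : ℝ) (ω : Ω) : ℕ :=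
  {k : ℕ | changeTime Y Z k ω ≤ t}.ncard

/-- The state after the first `n` changes (`false` is `0`, `true` is `1`). -/
def stateAfter (n : ℕ) : Bool := decide (Odd n)

/-- The state `S_X(t)` of the forwarding plane. -/
noncomputable def state (t : ℝ) (ω : Ω) : Bool :=
  stateAfter (changeCount Y Z t ω)

end Forwarding

/-- An update policy: each change of type I is reported with probability `reportUp`, each change
of type II with probability `reportDown`, and the control plane starts with the view `1` with
probability `initialUp`; all these random choices are independent. -/
structure UpdatePolicy where
  reportUp : unitInterval
  reportDown : unitInterval
  initialUp : unitInterval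

/-- The outcomes of the random choices of a policy: the initial view of the control plane, and
for each `k` whether the `k`-th change is reported. -/
abbrev Choices : Type := Bool × (ℕ → Bool)

/-- The joint law of the (independent) random choices of a policy. -/
noncomputable def UpdatePolicy.law (π : UpdatePolicy) : Measure Choices :=
  (bernoulliMeasure true false π.initialUp).prod
    (Measure.infinitePi fun k : ℕ =>
      bernoulliMeasure true false (if Even k then π.reportUp else π.reportDown))

/-- The view of the control plane after the first `n` changes: a reported change sets it to the
current state, an unreported one leaves it as it was. -/
def viewAfter (c : Choices) : ℕ → Bool
  | 0 => c.1
  | n + 1 => if c.2 n then stateAfter (n + 1) else viewAfter c n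

section Performance

variable {Ω : Type*} [MeasurableSpace Ω] (μ : Measure Ω) (Y Z : ℕ → Ω → ℝ)

/-- The state `Ŝ_X(t)` perceived by the control plane. -/
noncomputable def view (t : ℝ) (p : Ω × Choices) : Bool :=
  viewAfter p.2 (changeCount Y Z t p.1)

/-- The number of update packets sent during `[0, t]`. -/
noncomputable def updateCount (t : ℝ) (p : Ω × Choices) : ℕ :=
  {k : ℕ | changeTime Y Z k p.1 ≤ t ∧ p.2.2 k = true}.ncard

/-- The joint law of the alternating process and the policy's choices, which are independent of
the process. -/
noncomputable def jointLaw (π : UpdatePolicy) : Measure (Ω × Choices) := μ.prod π.law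

/-- `Pr (S_X(t) = s, Ŝ_X(t) = v)`. -/
noncomputable def jointProb (π : UpdatePolicy) (s v : Bool) (t : ℝ) : ℝ :=
  (jointLaw μ π).real {p | state Y Z t p.1 = s ∧ view Y Z t p = v}

/-- The long-run probability of `S_X = s, Ŝ_X = v`, i.e. the long-run expected proportion of the
time spent in this situation, exists and equals `D`. -/
def HasLongRunProb (π : UpdatePolicy) (s v : Bool) (D : ℝ) : Prop :=
  Tendsto (fun w : ℝ => w⁻¹ * ∫ t in (0 : ℝ)..w, jointProb μ Y Z π s v t) atTop (𝓝 D)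

/-- The distortion criterion: the false-negative distortion `D₁ = Pr (S_X = 1, Ŝ_X = 0)` is at
most `ε₁` and the false-positive distortion `D₂ = Pr (S_X = 0, Ŝ_X = 1)` is at most `ε₂`. -/
def MeetsCriterion (π : UpdatePolicy) (ε₁ ε₂ : ℝ) : Prop :=
  ∃ D₁ D₂ : ℝ, HasLongRunProb μ Y Z π true false D₁ ∧ HasLongRunProb μ Y Z π false true D₂ ∧
    D₁ ≤ ε₁ ∧ D₂ ≤ ε₂

/-- The update rate: the long-run expected number of update packets per unit of time exists and
equals `R`. -/
def HasUpdateRate (π : UpdatePolicy) (R : ℝ) : Prop :=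
  Tendsto (fun w : ℝ => w⁻¹ * ∫ p, (updateCount Y Z w p : ℝ) ∂(jointLaw μ π)) atTop (𝓝 R)

end Performance

/-- Almost surely, no update packet is ever sent: no change is ever reported. -/
def NeverUpdates (π : UpdatePolicy) : Prop :=
  ∀ᵐ c ∂π.law, ∀ k : ℕ, c.2 k = false

/-- The parameter region in which updates are needed; the bound `(1 - ε₁) / ε₁` is infinite for
`ε₁ = 0`. -/
def UpdatesNeeded (τ θ ε₁ ε₂ : ℝ) : Prop :=
  ε₂ / (1 - ε₂) < θ / τ ∧ (ε₁ = 0 ∨ θ / τ < (1 - ε₁) / ε₁) ∧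
    ε₂ * τ + ε₁ * θ < τ * θ / (τ + θ)

/-!
Let `N t` be the number of changes of state up to time `t`. The choices of a policy are independent
of the process, so that `Pr (S_X(t) = s, Ŝ_X(t) = v) = E (G (N t))`, where `G n` is the probability
of this situation after `n` changes (`jointProb_eq_integral`). The probability that the view is `1`
obeys an affine recursion over the changes, with factor `(1 - U¹) (1 - U²)` over a cycle, where
`U¹` and `U²` are the probabilities of reporting a change `0 → 1` and `1 → 0`; hence it converges
to some `x` along the down periods and to some `y` along the up periods, where
`1 - y = (1 - x) (1 - U¹)` and `x = y (1 - U²)` (`UpdatePolicy.exists_tendsto_probViewUp`).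

The strong law of large numbers for the `Y m` and for the `Z m` separately shows that almost surely
a fraction `τ / (τ + θ)` of the time is spent in up periods, and dominated convergence turns this
into `D₁ = (1 - y) τ / (τ + θ)` and `D₂ = x θ / (τ + θ)`. For the update rate
`(U¹ + U²) / (τ + θ)` the almost sure statement has to be complemented by a tail bound on the
number of changes; it comes from Chernoff's inequality for the sums of the down periods, which are
independent among themselves (`tendsto_inv_mul_tsum_measure_le`).

It remains to minimize `U¹ + U² = 2 - (1 - y) / (1 - x) - x / y` subject to
`1 - y ≤ p = ε₁ / (τ / (τ + θ))` and `x ≤ q = ε₂ / (θ / (τ + θ))`. The region in which updates are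
needed is just `p + q < 1`. There both quotients are largest for `1 - y = p` and `x = q`, and a
policy attains these values. If `p + q ≥ 1`, a constant random view meets the criterion.
-/

/-! ### Time averages along a path of the process -/

lemma ncard_setOf_le_eq {T : ℕ → ℝ} (hT : Monotone T) {t : ℝ} {n : ℕ}
    (h₁ : ∀ k < n, T k ≤ t) (h₂ : t < T n) : {k : ℕ | T k ≤ t}.ncard = n := by
  have : {k : ℕ | T k ≤ t} = ↑(Finset.range n) := by
    ext k
    simp only [Set.mem_ofPred_eq, Finset.coe_range, Set.mem_Iio]
    refine ⟨fun h => ?_, h₁ k⟩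
    by_contra hk
    exact absurd (hT (not_lt.1 hk)) (not_le.2 (h.trans_lt h₂))
  rw [this, Set.ncard_coe_finset, Finset.card_range]

lemma tendsto_atTop_of_tendsto_div {C : ℕ → ℝ} {σ : ℝ} (hσ : 0 < σ)
    (hC : Tendsto (fun m : ℕ => C m / m) atTop (𝓝 σ)) : Tendsto C atTop atTop := by
  refine (hC.pos_mul_atTop hσ tendsto_natCast_atTop_atTop).congr' ?_
  filter_upwards [eventually_gt_atTop 0] with m hm
  have : (m : ℝ) ≠ 0 := by positivity
  field_simp

/-- A nondecreasing `F` whose values along a sequence of epochs `C m ∼ σ m` satisfy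
`F (C m) ∼ ρ m` grows linearly with slope `ρ / σ`: between two epochs, `F w / w` is squeezed
between `F (C m) / C (m + 1)` and `F (C (m + 1)) / C m`. -/
lemma tendsto_inv_mul_of_monotone {F : ℝ → ℝ} {C : ℕ → ℝ} {σ ρ : ℝ} (hF : Monotone F)
    (hF0 : F 0 = 0) (hC : Monotone C) (hC0 : C 0 = 0) (hσ : 0 < σ)
    (hCσ : Tendsto (fun m : ℕ => C m / m) atTop (𝓝 σ))
    (hFρ : Tendsto (fun m : ℕ => F (C m) / m) atTop (𝓝 ρ)) :
    Tendsto (fun w : ℝ => w⁻¹ * F w) atTop (𝓝 (ρ / σ)) := by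
  have hCtop : Tendsto C atTop atTop := tendsto_atTop_of_tendsto_div hσ hCσ
  have hex : ∀ w : ℝ, ∃ m : ℕ, 0 ≤ w → C m ≤ w ∧ w < C (m + 1) := by
    intro w
    by_cases hw : 0 ≤ w
    · have h : ∃ m, w < C m := (hCtop.eventually_gt_atTop w).exists
      obtain ⟨k, hk⟩ : ∃ k, Nat.find h = k + 1 := by
        refine Nat.exists_eq_succ_of_ne_zero fun h0 => ?_
        have := Nat.find_spec h
        rw [h0, hC0] at this
        linarith
      refine ⟨k, fun _ => ⟨not_lt.1 (Nat.find_min h (by omega)), ?_⟩⟩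
      rw [← hk]
      exact Nat.find_spec h
    · exact ⟨0, fun h => absurd h hw⟩
  choose m hm using hex
  have hmtop : Tendsto m atTop atTop := by
    refine tendsto_atTop.2 fun K => ?_
    filter_upwards [eventually_ge_atTop 0, eventually_ge_atTop (C K)] with w hw hK
    by_contra hlt
    have := hC (show m w + 1 ≤ K by omega)
    linarith [(hm w hw).2]
  have hshift : Tendsto (fun n : ℕ => (n : ℝ) / (n + 1 : ℕ)) atTop (𝓝 1) := by
    simpa using tendsto_natCast_div_add_atTop (1 : ℝ)
  have hshift' : Tendsto (fun n : ℕ => ((n + 1 : ℕ) : ℝ) / n) atTop (𝓝 1) := by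
    have := hshift.inv₀ one_ne_zero
    simpa using this
  have hlow : Tendsto (fun n : ℕ => F (C n) / C (n + 1)) atTop (𝓝 (ρ / σ)) := by
    have h := (hFρ.mul hshift).div (hCσ.comp (tendsto_add_atTop_nat 1)) hσ.ne'
    rw [mul_one] at h
    refine h.congr' ?_
    filter_upwards [eventually_gt_atTop 0] with n hn
    have : (n : ℝ) ≠ 0 := by positivity
    have : ((n + 1 : ℕ) : ℝ) ≠ 0 := by positivity
    simp only [Function.comp, Pi.div_apply]
    field_simp
  have hupp : Tendsto (fun n : ℕ => F (C (n + 1)) / C n) atTop (𝓝 (ρ / σ)) := by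
    have h := ((hFρ.comp (tendsto_add_atTop_nat 1)).mul hshift').div hCσ hσ.ne'
    rw [mul_one] at h
    refine h.congr' ?_
    filter_upwards [eventually_gt_atTop 0] with n hn
    have : (n : ℝ) ≠ 0 := by positivity
    have : ((n + 1 : ℕ) : ℝ) ≠ 0 := by positivity
    simp only [Function.comp, Pi.div_apply]
    field_simp
  refine tendsto_of_tendsto_of_tendsto_of_le_of_le' (hlow.comp hmtop) (hupp.comp hmtop) ?_ ?_
  · filter_upwards [eventually_gt_atTop 0] with w hw
    obtain ⟨h1, h2⟩ := hm w hw.le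
    have h0 : 0 ≤ F (C (m w)) := hF0 ▸ hF (hC0 ▸ hC (Nat.zero_le _))
    rw [inv_mul_eq_div]
    exact div_le_div₀ (h0.trans (hF h1)) (hF h1) hw h2.le
  · filter_upwards [eventually_gt_atTop 0,
      (hCtop.comp hmtop).eventually_gt_atTop 0] with w hw hCw
    obtain ⟨h1, h2⟩ := hm w hw.le
    have h0 : 0 ≤ F w := hF0 ▸ hF hw.le
    rw [inv_mul_eq_div]
    exact div_le_div₀ (h0.trans (hF h2.le)) (hF h2.le) hCw h1

/-- Averages are unaffected by weights that converge: the deviation of the weighted sum is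
`o(∑ y i)`. -/
lemma tendsto_weighted_average {g y : ℕ → ℝ} {a θ : ℝ} (hg : Tendsto g atTop (𝓝 a))
    (hy : ∀ i, 0 ≤ y i) (hθ : 0 < θ)
    (hyθ : Tendsto (fun m : ℕ => (∑ i ∈ Finset.range m, y i) / m) atTop (𝓝 θ)) :
    Tendsto (fun m : ℕ => (∑ i ∈ Finset.range m, g i * y i) / m) atTop (𝓝 (a * θ)) := by
  have htop : Tendsto (fun m : ℕ => ∑ i ∈ Finset.range m, y i) atTop atTop :=
    tendsto_atTop_of_tendsto_div hθ hyθ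
  have hlit : (fun i => (g i - a) * y i) =o[atTop] y := by
    have h1 : (fun i => g i - a) =o[atTop] (fun _ => (1 : ℝ)) := by
      rw [Asymptotics.isLittleO_one_iff]
      simpa using hg.sub_const a
    simpa using h1.mul_isBigO (Asymptotics.isBigO_refl y atTop)
  have hsum := (hlit.sum_range hy htop).tendsto_div_nhds_zero
  have h := (hsum.mul hyθ).add (hyθ.const_mul a)
  rw [zero_mul, zero_add] at h
  refine h.congr' ?_
  filter_upwards [htop.eventually_gt_atTop 0] with m hm
  simp only [sub_mul, Finset.sum_sub_distrib, ← Finset.mul_sum]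
  field_simp
  ring

section Path

variable {Ω : Type*} {Y Z : ℕ → Ω → ℝ} {ω : Ω}

lemma periodLength_pos (hY : ∀ m, 0 < Y m ω) (hZ : ∀ m, 0 < Z m ω) (k : ℕ) :
    0 < periodLength Y Z k ω := by
  unfold periodLength
  split_ifs
  exacts [hY _, hZ _]

lemma sum_range_two_mul_periodLength (G : ℕ → ℝ) (m : ℕ) :
    ∑ i ∈ Finset.range (2 * m), G i * periodLength Y Z i ω =
      (∑ i ∈ Finset.range m, G (2 * i) * Y i ω) +
        ∑ i ∈ Finset.range m, G (2 * i + 1) * Z i ω := by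
  induction m with
  | zero => simp
  | succ m ih =>
    have h1 : periodLength Y Z (2 * m) ω = Y m ω := by simp [periodLength]
    have h2 : periodLength Y Z (2 * m + 1) ω = Z m ω := by
      have : (2 * m + 1) / 2 = m := by omega
      simp [periodLength, this]
    rw [show 2 * (m + 1) = 2 * m + 1 + 1 by ring, Finset.sum_range_succ, Finset.sum_range_succ,
      ih, h1, h2, Finset.sum_range_succ, Finset.sum_range_succ]
    ring

lemma sum_periodLength_two_mul (m : ℕ) :
    ∑ i ∈ Finset.range (2 * m), periodLength Y Z i ω =
      (∑ i ∈ Finset.range m, Y i ω) + ∑ i ∈ Finset.range m, Z i ω := by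
  simpa using sum_range_two_mul_periodLength (Y := Y) (Z := Z) (ω := ω) (fun _ => 1) m

lemma changeCount_eq (hY : ∀ m, 0 < Y m ω) (hZ : ∀ m, 0 < Z m ω) {n : ℕ} {t : ℝ}
    (h₁ : ∑ i ∈ Finset.range n, periodLength Y Z i ω ≤ t)
    (h₂ : t < ∑ i ∈ Finset.range (n + 1), periodLength Y Z i ω) :
    changeCount Y Z t ω = n := by
  have hmono : Monotone fun n => ∑ i ∈ Finset.range n, periodLength Y Z i ω :=
    monotone_nat_of_le_succ fun k => by
      rw [Finset.sum_range_succ]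
      linarith [periodLength_pos hY hZ k]
  refine ncard_setOf_le_eq (T := fun k => changeTime Y Z k ω)
    (fun i j hij => hmono (Nat.succ_le_succ hij)) (fun k hk => ?_) h₂
  exact (hmono (Nat.succ_le_of_lt hk)).trans h₁

/-- The long-run average of a function of the number of changes. If the function converges along
the even (down) periods to `a` and along the odd (up) periods to `b`, the average is the
combination of `a` and `b` weighted by the mean lengths of the periods. -/
lemma tendsto_average_changeCount {τ θ a b : ℝ} {G : ℕ → ℝ}
    (hY : ∀ m, 0 < Y m ω) (hZ : ∀ m, 0 < Z m ω) (hθ : 0 < θ) (hτ : 0 < τ)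
    (hYθ : Tendsto (fun m : ℕ => (∑ i ∈ Finset.range m, Y i ω) / m) atTop (𝓝 θ))
    (hZτ : Tendsto (fun m : ℕ => (∑ i ∈ Finset.range m, Z i ω) / m) atTop (𝓝 τ))
    (hN : Measurable fun t => changeCount Y Z t ω)
    (hG0 : ∀ n, 0 ≤ G n) (hG1 : ∀ n, G n ≤ 1)
    (ha : Tendsto (fun i => G (2 * i)) atTop (𝓝 a))
    (hb : Tendsto (fun i => G (2 * i + 1)) atTop (𝓝 b)) :
    Tendsto (fun w : ℝ => w⁻¹ * ∫ t in (0 : ℝ)..w, G (changeCount Y Z t ω)) atTop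
      (𝓝 ((a * θ + b * τ) / (θ + τ))) := by
  set S : ℕ → ℝ := fun n => ∑ i ∈ Finset.range n, periodLength Y Z i ω with hS
  have hSmono : Monotone S := monotone_nat_of_le_succ fun k => by
    simp only [hS, Finset.sum_range_succ]
    linarith [periodLength_pos hY hZ k]
  have hint : ∀ u v : ℝ, IntervalIntegrable (fun t => G (changeCount Y Z t ω)) volume u v := by
    intro u v
    refine (intervalIntegrable_const (c := (1 : ℝ))).mono_fun
      ((measurable_from_top (f := G)).comp hN).aestronglyMeasurable
      (Eventually.of_forall fun t => ?_)
    simp [abs_of_nonneg (hG0 _), hG1]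
  have hper : ∀ n, ∫ t in (0 : ℝ)..S n, G (changeCount Y Z t ω) =
      ∑ i ∈ Finset.range n, G i * periodLength Y Z i ω := by
    intro n
    induction n with
    | zero => simp [hS]
    | succ n ih =>
      rw [← intervalIntegral.integral_add_adjacent_intervals (hint 0 (S n)) (hint _ _), ih,
        Finset.sum_range_succ]
      congr 1
      have hle : S n ≤ S (n + 1) := hSmono n.le_succ
      have : ∫ t in (S n)..S (n + 1), G (changeCount Y Z t ω) =
          ∫ t in (S n)..S (n + 1), G n := by
        rw [intervalIntegral.integral_of_le hle, intervalIntegral.integral_of_le hle,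
          ← integral_Ico_eq_integral_Ioc, ← integral_Ico_eq_integral_Ioc]
        refine setIntegral_congr_fun measurableSet_Ico fun t ht => ?_
        simp only [changeCount_eq hY hZ ht.1 ht.2]
      rw [this, intervalIntegral.integral_const]
      simp only [hS, Finset.sum_range_succ, smul_eq_mul]
      ring
  refine tendsto_inv_mul_of_monotone (C := fun m => S (2 * m)) ?_ ?_ ?_ ?_ (by positivity) ?_ ?_
  · intro u v huv
    rw [← sub_nonneg]
    simp only [intervalIntegral.integral_interval_sub_left (hint 0 v) (hint 0 u)]
    exact intervalIntegral.integral_nonneg huv fun t _ => hG0 _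
  · simp
  · intro i j hij
    exact hSmono (by omega)
  · simp [hS]
  · simp only [hS, sum_periodLength_two_mul, add_div]
    exact hYθ.add hZτ
  · simp only [hper, sum_range_two_mul_periodLength, add_div]
    exact (tendsto_weighted_average ha (fun i => (hY i).le) hθ hYθ).add
      (tendsto_weighted_average hb (fun i => (hZ i).le) hτ hZτ)

end Path

/-! ### Measurability and long-run probabilities -/

section Counting

variable {α : Type*} [MeasurableSpace α]

/-- For an infinite set both sides are `0`. -/
lemma natCast_ncard_eq_toReal_tsum (s : Set ℕ) :
    (s.ncard : ℝ) = (∑' k, s.indicator (fun _ => (1 : ENNReal)) k).toReal := by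
  rw [← tsum_subtype, ENNReal.tsum_set_one, Set.ncard_def]
  rcases eq_or_ne s.encard ⊤ with h | h
  · simp [h]
  · lift s.encard to ℕ using h with n
    simp

lemma measurable_ncard_setOf {p : ℕ → α → Prop} (hp : ∀ k, MeasurableSet {x | p k x}) :
    Measurable fun x => {k : ℕ | p k x}.ncard :=
  measurable_ncard.comp (measurable_set_iff.2 fun k => measurableSet_setOfPred.1 (hp k))

end Counting

section Fubini

variable {Ω : Type*} [MeasurableSpace Ω] {μ : Measure Ω} {Y Z : ℕ → Ω → ℝ} {τ θ : ℝ}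

namespace IsAlternatingProcess

variable (hX : IsAlternatingProcess μ Y Z τ θ)
include hX

lemma measurable_periodLength (k : ℕ) : Measurable (periodLength Y Z k) := by
  unfold periodLength
  split_ifs
  exacts [hX.measurable_down _, hX.measurable_up _]

lemma measurable_changeTime (k : ℕ) : Measurable (changeTime Y Z k) := by
  unfold changeTime
  exact Finset.measurable_sum _ fun i _ => hX.measurable_periodLength i

lemma measurable_changeCount :
    Measurable (Function.uncurry (changeCount Y Z)) :=
  measurable_ncard_setOf (p := fun k (q : ℝ × Ω) => changeTime Y Z k q.2 ≤ q.1) fun k =>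
    measurableSet_le ((hX.measurable_changeTime k).comp measurable_snd) measurable_fst

lemma ae_pos : ∀ᵐ ω ∂μ, (∀ m, 0 < Y m ω) ∧ ∀ m, 0 < Z m ω := by
  filter_upwards [ae_all_iff.2 hX.down_pos, ae_all_iff.2 hX.up_pos] with ω h1 h2
  exact ⟨h1, h2⟩

lemma down_mean_pos [IsProbabilityMeasure μ] : 0 < θ := by
  rw [← hX.mean_down, integral_pos_iff_support_of_nonneg_ae
    ((hX.down_pos 0).mono fun _ h => h.le) hX.integrable_down]
  have h : Function.support (Y 0) =ᵐ[μ] Set.univ :=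
    eventuallyEq_univ.2 ((hX.down_pos 0).mono fun _ h => h.ne')
  simp [measure_congr h]

lemma up_mean_pos [IsProbabilityMeasure μ] : 0 < τ := by
  rw [← hX.mean_up, integral_pos_iff_support_of_nonneg_ae
    ((hX.up_pos 0).mono fun _ h => h.le) hX.integrable_up]
  have h : Function.support (Z 0) =ᵐ[μ] Set.univ :=
    eventuallyEq_univ.2 ((hX.up_pos 0).mono fun _ h => h.ne')
  simp [measure_congr h]

lemma ae_tendsto_down :
    ∀ᵐ ω ∂μ, Tendsto (fun m : ℕ => (∑ i ∈ Finset.range m, Y i ω) / m) atTop (𝓝 θ) := by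
  rw [← hX.mean_down]
  exact strong_law_ae_real Y hX.integrable_down (fun _ _ h => hX.indep_down.indepFun h)
    hX.identDistrib_down

lemma ae_tendsto_up :
    ∀ᵐ ω ∂μ, Tendsto (fun m : ℕ => (∑ i ∈ Finset.range m, Z i ω) / m) atTop (𝓝 τ) := by
  rw [← hX.mean_up]
  exact strong_law_ae_real Z hX.integrable_up (fun _ _ h => hX.indep_up.indepFun h)
    hX.identDistrib_up

/-- The long-run expectation of a function of the number of changes: the almost sure limit of the
time averages passes to the expectation by dominated convergence. -/
lemma tendsto_average_integral_changeCount [IsProbabilityMeasure μ] {a b : ℝ} {G : ℕ → ℝ}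
    (hG0 : ∀ n, 0 ≤ G n) (hG1 : ∀ n, G n ≤ 1)
    (ha : Tendsto (fun i => G (2 * i)) atTop (𝓝 a))
    (hb : Tendsto (fun i => G (2 * i + 1)) atTop (𝓝 b)) :
    Tendsto (fun w : ℝ => w⁻¹ * ∫ t in (0 : ℝ)..w, ∫ ω, G (changeCount Y Z t ω) ∂μ) atTop
      (𝓝 ((a * θ + b * τ) / (θ + τ))) := by
  have hmeas : Measurable fun q : ℝ × Ω => G (changeCount Y Z q.1 q.2) :=
    (measurable_from_top (f := G)).comp hX.measurable_changeCount
  have hbound : ∀ n, ‖G n‖ ≤ 1 := fun n => by rw [Real.norm_of_nonneg (hG0 n)]; exact hG1 n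
  have hswap : ∀ w : ℝ, w⁻¹ * ∫ t in (0 : ℝ)..w, ∫ ω, G (changeCount Y Z t ω) ∂μ =
      ∫ ω, w⁻¹ * (∫ t in (0 : ℝ)..w, G (changeCount Y Z t ω)) ∂μ := by
    intro w
    rw [integral_const_mul, intervalIntegral_integral_swap]
    have : IsFiniteMeasure (volume.restrict (Set.uIoc 0 w)) := by
      unfold Set.uIoc
      infer_instance
    exact Integrable.of_bound hmeas.aestronglyMeasurable 1
      (Eventually.of_forall fun q => hbound _)
  have hlim : (a * θ + b * τ) / (θ + τ) = ∫ _, (a * θ + b * τ) / (θ + τ) ∂μ := by simp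
  simp only [hswap]
  rw [hlim]
  refine tendsto_integral_filter_of_dominated_convergence (fun _ => 1) ?_ ?_
    (integrable_const _) ?_
  · refine Eventually.of_forall fun w => ?_
    refine (Measurable.const_mul ?_ _).aestronglyMeasurable
    simp only [intervalIntegral]
    have h : ∀ ν : Measure ℝ, SFinite ν →
        Measurable fun ω => ∫ t, G (changeCount Y Z t ω) ∂ν := fun ν _ =>
      ((hmeas.comp measurable_swap).stronglyMeasurable.integral_prod_right' (ν := ν)).measurable
    exact (h _ inferInstance).sub (h _ inferInstance)
  · filter_upwards [eventually_gt_atTop 0] with w hw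
    refine Eventually.of_forall fun ω => ?_
    have := intervalIntegral.norm_integral_le_of_norm_le_const (a := 0) (b := w)
      (f := fun t => G (changeCount Y Z t ω)) (C := 1) fun t _ => hbound _
    rw [norm_mul, norm_inv, Real.norm_of_nonneg hw.le]
    rw [sub_zero, one_mul, abs_of_pos hw] at this
    exact (inv_mul_le_one₀ hw).2 this
  · filter_upwards [hX.ae_pos, hX.ae_tendsto_down, hX.ae_tendsto_up] with ω hpos hd hu
    exact tendsto_average_changeCount hpos.1 hpos.2 hX.down_mean_pos hX.up_mean_pos hd hu
      hX.measurable_changeCount.of_uncurry_right hG0 hG1 ha hb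

end IsAlternatingProcess

instance UpdatePolicy.isProbabilityMeasure_law (π : UpdatePolicy) :
    IsProbabilityMeasure π.law := by
  unfold UpdatePolicy.law
  infer_instance

lemma measurable_viewAfter (n : ℕ) : Measurable fun c : Choices => viewAfter c n := by
  induction n with
  | zero => exact measurable_fst
  | succ n ih =>
    have h : MeasurableSet {c : Choices | c.2 n = true} :=
      measurableSet_eq_fun ((measurable_pi_apply n).comp measurable_snd) measurable_const
    exact Measurable.ite h measurable_const ih

/-- The probability of `S_X = s, Ŝ_X = v` after `n` changes. -/
noncomputable def UpdatePolicy.probAfter (π : UpdatePolicy) (s v : Bool) (n : ℕ) : ℝ :=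
  π.law.real {c | stateAfter n = s ∧ viewAfter c n = v}

/-- By independence, conditioning on the process replaces the random choices by their law. -/
lemma jointProb_eq_integral [IsProbabilityMeasure μ] (hX : IsAlternatingProcess μ Y Z τ θ)
    (π : UpdatePolicy) (s v : Bool) (t : ℝ) :
    jointProb μ Y Z π s v t = ∫ ω, π.probAfter s v (changeCount Y Z t ω) ∂μ := by
  have hN : Measurable fun ω => changeCount Y Z t ω :=
    hX.measurable_changeCount.of_uncurry_left
  have hset : MeasurableSet {p : Ω × Choices | state Y Z t p.1 = s ∧ view Y Z t p = v} := by
    have h : Measurable (β := Bool × Bool) fun q : ℕ × Choices =>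
        (stateAfter q.1, viewAfter q.2 q.1) :=
      measurable_from_prod_countable_right fun n =>
        (measurable_const (a := stateAfter n)).prodMk (measurable_viewAfter n)
    have h2 := h.comp ((hN.comp measurable_fst).prodMk (measurable_snd (α := Ω) (β := Choices)))
    have h3 := h2 (measurableSet_singleton (s, v))
    convert h3 using 1
    ext p
    simp [state, view]
  rw [jointProb, jointLaw, measureReal_def, Measure.prod_apply hset,
    ← integral_toReal (measurable_measure_prodMk_left hset).aemeasurable
      (Eventually.of_forall fun ω => measure_lt_top _ _)]
  rfl

/-- The long-run probabilities, from the limits of the view after an even and after an odd number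
of changes. -/
lemma hasLongRunProb_of_tendsto [IsProbabilityMeasure μ] (hX : IsAlternatingProcess μ Y Z τ θ)
    {π : UpdatePolicy} {s v : Bool} {a b : ℝ}
    (ha : Tendsto (fun i => π.probAfter s v (2 * i)) atTop (𝓝 a))
    (hb : Tendsto (fun i => π.probAfter s v (2 * i + 1)) atTop (𝓝 b)) :
    HasLongRunProb μ Y Z π s v ((a * θ + b * τ) / (θ + τ)) := by
  unfold HasLongRunProb
  simp only [jointProb_eq_integral hX]
  exact hX.tendsto_average_integral_changeCount (fun _ => measureReal_nonneg)
    (fun _ => measureReal_le_one) ha hb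

end Fubini

/-! ### The elementary renewal theorem -/

section Renewal

/-- A series as an integral over the half-line, at scale `w`: the point `x` stands for the index
`⌊w * x⌋₊`, and each index occupies an interval of length `w⁻¹`. -/
lemma lintegral_floor_mul {w : ℝ} (hw : 0 < w) (f : ℕ → ENNReal) :
    ∫⁻ x in Set.Ici (0 : ℝ), f ⌊w * x⌋₊ = ENNReal.ofReal w⁻¹ * ∑' j, f j := by
  have hm : Measurable fun x : ℝ => ⌊w * x⌋₊ :=
    Nat.measurable_floor.comp (measurable_const_mul w)
  have hmap : (volume.restrict (Set.Ici (0 : ℝ))).map (fun x : ℝ => ⌊w * x⌋₊) =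
      ENNReal.ofReal w⁻¹ • Measure.count := by
    refine Measure.ext_of_singleton fun n => ?_
    rw [Measure.map_apply hm (measurableSet_singleton n),
      Measure.restrict_apply (hm (measurableSet_singleton n))]
    have hpre : (fun x : ℝ => ⌊w * x⌋₊) ⁻¹' {n} ∩ Set.Ici 0 =
        Set.Ico ((n : ℝ) / w) ((n + 1) / w) := by
      ext x
      simp only [Set.mem_inter_iff, Set.mem_preimage, Set.mem_singleton_iff, Set.mem_Ici,
        Set.mem_Ico, div_le_iff₀ hw, lt_div_iff₀ hw]
      constructor
      · rintro ⟨h, hx⟩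
        have := (Nat.floor_eq_iff (mul_nonneg hw.le hx)).1 h
        constructor <;> linarith [this.1, this.2, mul_comm w x]
      · rintro ⟨h1, h2⟩
        have hx : 0 ≤ x := by
          have : 0 ≤ x * w := (Nat.cast_nonneg n).trans h1
          exact nonneg_of_mul_nonneg_left this hw
        refine ⟨(Nat.floor_eq_iff (mul_nonneg hw.le hx)).2 ?_, hx⟩
        constructor <;> linarith [mul_comm w x]
    rw [hpre, Real.volume_Ico]
    simp only [Measure.smul_apply, Measure.count_singleton, smul_eq_mul, mul_one]
    congr 1
    field_simp
    ring
  rw [← lintegral_map (measurable_from_top (f := f)) hm, hmap, lintegral_smul_measure,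
    lintegral_count, smul_eq_mul]

variable {Ω : Type*} [MeasurableSpace Ω] {μ : Measure Ω} [IsProbabilityMeasure μ]

/-- Exponential tail bound for the partial sums of positive i.i.d. variables. By Chernoff with
parameter `-1 / w`, it rests on `E exp (-Y / w) ≤ 1 - c / w` with `c = 1 - E exp (-Y)`, which is
Bernoulli's inequality for the concave power `1 / w`. -/
lemma exists_measureReal_sum_le_exp {Y : ℕ → Ω → ℝ} (hm : ∀ i, Measurable (Y i))
    (hpos : ∀ i, ∀ᵐ ω ∂μ, 0 < Y i ω) (hind : iIndepFun Y μ)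
    (hid : ∀ i, IdentDistrib (Y i) (Y 0) μ μ) :
    ∃ c > 0, ∀ w : ℝ, 1 ≤ w → ∀ j : ℕ,
      μ.real {ω | ∑ i ∈ Finset.range j, Y i ω ≤ w} ≤ Real.exp (1 - c * (j / w)) := by
  have hint : ∀ w : ℝ, 0 < w → ∀ X : Ω → ℝ, Measurable X → (∀ᵐ ω ∂μ, 0 ≤ X ω) →
      Integrable (fun ω => Real.exp (-w⁻¹ * X ω)) μ := by
    intro w hw X hX hX0
    refine Integrable.of_bound (by fun_prop) 1 ?_
    filter_upwards [hX0] with ω hω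
    rw [Real.norm_of_nonneg (Real.exp_pos _).le, Real.exp_le_one_iff, neg_mul, neg_nonpos]
    positivity
  have hint0 : ∀ w : ℝ, 0 < w → Integrable (fun ω => Real.exp (-w⁻¹ * Y 0 ω)) μ := fun w hw =>
    hint w hw _ (hm 0) ((hpos 0).mono fun _ h => h.le)
  have hint1 : Integrable (fun ω => 1 - Real.exp (-Y 0 ω)) μ := by
    refine ((integrable_const (1 : ℝ)).sub (hint0 1 one_pos)).congr (ae_of_all _ fun ω => ?_)
    simp
  refine ⟨∫ ω, (1 - Real.exp (-Y 0 ω)) ∂μ, ?_, fun w hw j => ?_⟩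
  · rw [gt_iff_lt, integral_pos_iff_support_of_nonneg_ae ?_ hint1]
    · have h : Function.support (fun ω => 1 - Real.exp (-Y 0 ω)) =ᵐ[μ] Set.univ := by
        refine eventuallyEq_univ.2 ((hpos 0).mono fun ω h => ?_)
        have : Real.exp (-Y 0 ω) < 1 := Real.exp_lt_one_iff.2 (by linarith)
        exact (sub_pos.2 this).ne'
      simp [measure_congr h]
    · filter_upwards [hpos 0] with ω h
      have : Real.exp (-Y 0 ω) ≤ 1 := Real.exp_le_one_iff.2 (by linarith)
      simpa using this
  · set c := ∫ ω, (1 - Real.exp (-Y 0 ω)) ∂μ with hc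
    have hw0 : 0 < w := by linarith
    have hmgf : mgf (Y 0) μ (-w⁻¹) ≤ Real.exp (-(c / w)) := by
      calc mgf (Y 0) μ (-w⁻¹) ≤ ∫ ω, (1 - w⁻¹ * (1 - Real.exp (-Y 0 ω))) ∂μ := by
            refine integral_mono (hint0 w hw0)
              ((integrable_const _).sub (hint1.const_mul _)) fun ω => ?_
            have := rpow_one_add_le_one_add_mul_self (s := Real.exp (-Y 0 ω) - 1) (p := w⁻¹)
              (by linarith [Real.exp_pos (-Y 0 ω)]) (by positivity) (inv_le_one_of_one_le₀ hw)
            rw [add_sub_cancel, ← Real.exp_mul] at this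
            dsimp only
            rw [show -w⁻¹ * Y 0 ω = -Y 0 ω * w⁻¹ by ring]
            linarith
        _ = 1 - c / w := by
            rw [integral_sub (integrable_const _) (hint1.const_mul _), integral_const_mul]
            simp [hc, div_eq_inv_mul]
        _ ≤ Real.exp (-(c / w)) := by linarith [Real.add_one_le_exp (-(c / w))]
    have hsum0 : ∀ᵐ ω ∂μ, 0 ≤ (∑ i ∈ Finset.range j, Y i) ω := by
      filter_upwards [ae_all_iff.2 hpos] with ω h
      rw [Finset.sum_apply]
      exact Finset.sum_nonneg fun i _ => (h i).le
    have h := measure_le_le_exp_mul_mgf (μ := μ) (X := ∑ i ∈ Finset.range j, Y i) (t := -w⁻¹) w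
      (by simpa using hw0.le)
      (hint w hw0 _ (by fun_prop) hsum0)
    rw [hind.mgf_sum hm,
      Finset.prod_congr rfl fun i _ => congrFun (mgf_congr_identDistrib (hid i)) _,
      Finset.prod_const, Finset.card_range, neg_neg, inv_mul_cancel₀ hw0.ne'] at h
    simp only [Finset.sum_apply] at h
    refine h.trans ?_
    calc Real.exp 1 * mgf (Y 0) μ (-w⁻¹) ^ j ≤ Real.exp 1 * Real.exp (-(c / w)) ^ j := by
          gcongr
          exact mgf_nonneg
      _ = Real.exp (1 - c * (j / w)) := by
          rw [← Real.exp_nat_mul, ← Real.exp_add]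
          congr 1
          ring

/-- The **elementary renewal theorem** for epochs `V j ∼ σ j` that dominate the partial sums of
positive i.i.d. variables: the expected number of epochs in `[0, w]` is asymptotic to `w / σ`.
The normalized sum of `P (V j ≤ w)` over `j` is the integral over `x ≥ 0` of
`P (V ⌊w * x⌋₊ ≤ w)`, which tends to `1` for `x < 1 / σ` and to `0` for `x > 1 / σ`. -/
lemma tendsto_inv_mul_tsum_measure_le {Y V : ℕ → Ω → ℝ} {σ : ℝ} (hσ : 0 < σ)
    (hm : ∀ i, Measurable (Y i)) (hpos : ∀ i, ∀ᵐ ω ∂μ, 0 < Y i ω) (hind : iIndepFun Y μ)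
    (hid : ∀ i, IdentDistrib (Y i) (Y 0) μ μ) (hVm : ∀ j, Measurable (V j))
    (hYV : ∀ j, ∀ᵐ ω ∂μ, ∑ i ∈ Finset.range j, Y i ω ≤ V j ω)
    (hV : ∀ᵐ ω ∂μ, Tendsto (fun j : ℕ => V j ω / j) atTop (𝓝 σ)) :
    Tendsto (fun w : ℝ => ENNReal.ofReal w⁻¹ * ∑' j, μ {ω | V j ω ≤ w}) atTop
      (𝓝 (ENNReal.ofReal σ⁻¹)) := by
  obtain ⟨c, hc, hbound⟩ := exists_measureReal_sum_le_exp hm hpos hind hid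
  have hlim : ENNReal.ofReal σ⁻¹ =
      ∫⁻ x in Set.Ici (0 : ℝ), (Set.Iio σ⁻¹).indicator (fun _ => (1 : ENNReal)) x := by
    rw [lintegral_indicator measurableSet_Iio, Measure.restrict_restrict measurableSet_Iio,
      setLIntegral_const, one_mul, Set.inter_comm, Set.Ici_inter_Iio, Real.volume_Ico, sub_zero]
  rw [hlim]
  refine Tendsto.congr' (f₁ := fun w : ℝ =>
    ∫⁻ x in Set.Ici (0 : ℝ), μ {ω | V ⌊w * x⌋₊ ω ≤ w}) ?_ ?_
  · filter_upwards [eventually_gt_atTop 0] with w hw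
    exact lintegral_floor_mul hw fun j => μ {ω | V j ω ≤ w}
  refine tendsto_lintegral_filter_of_dominated_convergence
    (fun x => ENNReal.ofReal (Real.exp (1 + c) * Real.exp (-c * x))) ?_ ?_ ?_ ?_
  · refine Eventually.of_forall fun w => ?_
    exact (measurable_from_top (f := fun j => μ {ω | V j ω ≤ w})).comp
      (Nat.measurable_floor.comp (measurable_const_mul w))
  · filter_upwards [eventually_ge_atTop 1] with w hw
    filter_upwards [ae_restrict_mem measurableSet_Ici] with x hx
    have hw0 : 0 < w := by linarith
    have h1 : μ {ω | V ⌊w * x⌋₊ ω ≤ w} ≤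
        μ {ω | ∑ i ∈ Finset.range ⌊w * x⌋₊, Y i ω ≤ w} := by
      refine measure_mono_ae ?_
      filter_upwards [hYV ⌊w * x⌋₊] with ω h1 h2
      exact h1.trans h2
    refine h1.trans ?_
    rw [← ofReal_measureReal]
    refine ENNReal.ofReal_le_ofReal ((hbound w hw _).trans ?_)
    rw [← Real.exp_add, Real.exp_le_exp]
    have h2 : x - 1 ≤ (⌊w * x⌋₊ : ℝ) / w := by
      rw [le_div_iff₀ hw0]
      nlinarith [Nat.lt_floor_add_one (w * x)]
    nlinarith
  · refine Integrable.lintegral_lt_top ?_ |>.ne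
    have := (integrableOn_Ici_iff_integrableOn_Ioi (μ := volume)).2 (exp_neg_integrableOn_Ioi 0 hc)
    exact this.const_mul _
  · have hne : ∀ a : ℝ, ∀ᵐ x ∂(volume.restrict (Set.Ici (0 : ℝ))), x ≠ a := fun a =>
      ae_restrict_of_ae (measure_eq_zero_iff_ae_notMem.1 (measure_singleton a))
    filter_upwards [ae_restrict_mem measurableSet_Ici, hne 0, hne σ⁻¹] with x hx hx0 hxσ
    have hx' : 0 < x := lt_of_le_of_ne hx hx0.symm
    have hfloor : Tendsto (fun w : ℝ => (⌊x * w⌋₊ : ℝ) / w) atTop (𝓝 x) :=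
      tendsto_nat_floor_mul_div_atTop hx
    have hfloor_top : Tendsto (fun w : ℝ => ⌊x * w⌋₊) atTop atTop :=
      tendsto_nat_floor_atTop.comp (tendsto_id.const_mul_atTop hx')
    have hae : ∀ᵐ ω ∂μ, Tendsto (fun w : ℝ => V ⌊w * x⌋₊ ω / w) atTop (𝓝 (σ * x)) := by
      filter_upwards [hV] with ω hω
      refine ((hω.comp hfloor_top).mul hfloor).congr' ?_
      filter_upwards [hfloor_top.eventually_gt_atTop 0] with w hw
      have : ((⌊x * w⌋₊ : ℕ) : ℝ) ≠ 0 := by positivity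
      simp only [Function.comp, mul_comm w x]
      field_simp
    have hmeas : ∀ w : ℝ, MeasurableSet {ω | V ⌊w * x⌋₊ ω ≤ w} := fun w =>
      measurableSet_le (hVm _) measurable_const
    rcases lt_or_gt_of_ne hxσ with h | h
    · rw [Set.indicator_of_mem (Set.mem_Iio.2 h), ← measure_univ (μ := μ)]
      refine tendsto_measure_of_ae_tendsto_indicator_of_isFiniteMeasure atTop MeasurableSet.univ
        hmeas ?_
      filter_upwards [hae] with ω hω
      have hlt : σ * x < 1 := by rwa [← lt_inv_mul_iff₀ hσ, mul_one]
      filter_upwards [hω.eventually_lt_const hlt, eventually_gt_atTop 0] with w h1 h2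
      simpa using ((div_lt_one h2).1 h1).le
    · rw [Set.indicator_of_notMem (by simpa using h.le), ← measure_empty (μ := μ)]
      refine tendsto_measure_of_ae_tendsto_indicator_of_isFiniteMeasure atTop MeasurableSet.empty
        hmeas ?_
      filter_upwards [hae] with ω hω
      have hlt : 1 < σ * x := by rwa [← inv_mul_lt_iff₀ hσ, mul_one]
      filter_upwards [hω.eventually_const_lt hlt, eventually_gt_atTop 0] with w h1 h2
      simpa using (one_lt_div h2).1 h1

end Renewal

/-! ### The law of the view and the update rate -/

namespace UpdatePolicy

variable (π : UpdatePolicy)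

/-- The law of the reporting choices, without the initial view. -/
noncomputable def reportLaw : Measure (ℕ → Bool) :=
  Measure.infinitePi fun k : ℕ =>
    bernoulliMeasure true false (if Even k then π.reportUp else π.reportDown)

instance isProbabilityMeasure_reportLaw : IsProbabilityMeasure π.reportLaw := by
  unfold reportLaw
  infer_instance

lemma law_eq : π.law = (bernoulliMeasure true false π.initialUp).prod π.reportLaw := rfl

lemma map_eval_law (k : ℕ) : π.law.map (fun c => c.2 k) =
    bernoulliMeasure true false (if Even k then π.reportUp else π.reportDown) := by
  have h : (fun c : Choices => c.2 k) = (fun x : ℕ → Bool => x k) ∘ Prod.snd := rfl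
  rw [h, ← Measure.map_map (measurable_pi_apply k) measurable_snd, law_eq, Measure.map_snd_prod,
    measure_univ, one_smul]
  exact Measure.infinitePi_map_eval _ k

lemma law_report (k : ℕ) (b : Bool) : π.law {c | c.2 k = b} =
    bernoulliMeasure true false (if Even k then π.reportUp else π.reportDown) {b} := by
  rw [← map_eval_law, Measure.map_apply (by fun_prop) (measurableSet_singleton b)]
  rfl

lemma law_real_not_report (k : ℕ) : π.law.real {c | c.2 k = false} =
    1 - ((if Even k then π.reportUp else π.reportDown : unitInterval) : ℝ) := by
  rw [measureReal_def, law_report, ← measureReal_def]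
  simp

lemma reportLaw_report (k : ℕ) (b : Bool) : π.reportLaw {x | x k = b} = π.law {c | c.2 k = b} := by
  have : {c : Choices | c.2 k = b} = Set.univ ×ˢ {x | x k = b} := by
    ext c
    simp
  rw [this, law_eq, Measure.prod_prod, measure_univ, one_mul]

lemma law_real_initialUp : π.law.real {c | c.1 = true} = π.initialUp := by
  have : {c : Choices | c.1 = true} = {true} ×ˢ Set.univ := by
    ext c
    simp
  rw [this, law_eq, measureReal_prod_prod]
  simp

end UpdatePolicy

section View

lemma viewAfter_congr {b : Bool} {x x' : ℕ → Bool} {n : ℕ} (h : ∀ i < n, x i = x' i) :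
    viewAfter (b, x) n = viewAfter (b, x') n := by
  induction n with
  | zero => rfl
  | succ n ih =>
    simp only [viewAfter, h n n.lt_succ_self, ih fun i hi => h i (hi.trans n.lt_succ_self)]

namespace UpdatePolicy

variable (π : UpdatePolicy)

/-- Whether a change is reported is independent of the view before it, which is a function of the
initial view and of the earlier choices. -/
lemma law_real_viewAfter_and_not_report (n : ℕ) (v : Bool) :
    π.law.real {c | viewAfter c n = v ∧ c.2 n = false} =
      π.law.real {c | viewAfter c n = v} * π.law.real {c | c.2 n = false} := by
  have hind : ∀ b : Bool, IndepFun (fun x : ℕ → Bool => viewAfter (b, x) n) (fun x => x n)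
      π.reportLaw := by
    intro b
    have h := (iIndepFun_infinitePi (X := fun _ (y : Bool) => y) (P := fun k : ℕ =>
      bernoulliMeasure true false (if Even k then π.reportUp else π.reportDown))
      fun _ => measurable_id).indepFun_finset (Finset.range n) {n} (by simp)
      fun i => measurable_pi_apply i
    have h2 := h.comp
      (φ := fun r => viewAfter (b, fun i => if hi : i ∈ Finset.range n then r ⟨i, hi⟩ else false) n)
      (ψ := fun r => r ⟨n, Finset.mem_singleton_self n⟩)
      (measurable_of_finite _) (measurable_of_finite _)
    have h3 : (fun x : ℕ → Bool => viewAfter (b, x) n) =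
        (fun r : Finset.range n → Bool =>
          viewAfter (b, fun i => if hi : i ∈ Finset.range n then r ⟨i, hi⟩ else false) n) ∘
          fun x i => x i := by
      funext x
      refine viewAfter_congr fun i hi => ?_
      simp [hi]
    rw [h3]
    exact h2
  have hmA : MeasurableSet {c : Choices | viewAfter c n = v} :=
    measurableSet_eq_fun (measurable_viewAfter n) measurable_const
  have hmB : MeasurableSet {c : Choices | c.2 n = false} :=
    measurableSet_eq_fun (by fun_prop) measurable_const
  simp only [measureReal_def, ← ENNReal.toReal_mul]
  congr 1
  have hAB : MeasurableSet {c : Choices | viewAfter c n = v ∧ c.2 n = false} := hmA.inter hmB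
  rw [← reportLaw_report, law_eq, Measure.prod_apply hAB, Measure.prod_apply hmA,
    ← lintegral_mul_const _ (measurable_measure_prodMk_left hmA)]
  refine lintegral_congr fun b => ?_
  exact (hind b).measure_inter_preimage_eq_mul {v} {false} (measurableSet_singleton v)
    (measurableSet_singleton false)

/-- The probability that the view is `1` after `n` changes. -/
noncomputable def probViewUp (n : ℕ) : ℝ := π.law.real {c | viewAfter c n = true}

lemma law_real_viewAfter_false (n : ℕ) :
    π.law.real {c | viewAfter c n = false} = 1 - π.probViewUp n := by
  have h := probReal_compl_eq_one_sub (μ := π.law) (s := {c | viewAfter c n = true})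
    (measurableSet_eq_fun (measurable_viewAfter n) measurable_const)
  rw [probViewUp, ← h]
  congr 1
  ext c
  simp

lemma probViewUp_zero : π.probViewUp 0 = π.initialUp := π.law_real_initialUp

lemma probViewUp_two_mul_add_one (j : ℕ) :
    π.probViewUp (2 * j + 1) = 1 - (1 - π.probViewUp (2 * j)) * (1 - π.reportUp) := by
  have hset : {c : Choices | viewAfter c (2 * j + 1) = false} =
      {c | viewAfter c (2 * j) = false ∧ c.2 (2 * j) = false} := by
    ext c
    have : stateAfter (2 * j + 1) = true := by simp [stateAfter]
    simp only [Set.mem_ofPred_eq, viewAfter, this]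
    cases c.2 (2 * j) <;> simp
  have h := π.law_real_viewAfter_false (2 * j + 1)
  rw [hset, law_real_viewAfter_and_not_report, law_real_viewAfter_false,
    law_real_not_report, if_pos (even_two_mul j)] at h
  linarith

lemma probViewUp_two_mul_add_two (j : ℕ) :
    π.probViewUp (2 * (j + 1)) = π.probViewUp (2 * j + 1) * (1 - π.reportDown) := by
  have hset : {c : Choices | viewAfter c (2 * (j + 1)) = true} =
      {c | viewAfter c (2 * j + 1) = true ∧ c.2 (2 * j + 1) = false} := by
    ext c
    have : stateAfter (2 * j + 1 + 1) = false := by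
      simp [stateAfter, Nat.even_add_one]
    simp only [show 2 * (j + 1) = 2 * j + 1 + 1 by ring, Set.mem_ofPred_eq, viewAfter, this]
    cases c.2 (2 * j + 1) <;> simp
  rw [probViewUp, hset, law_real_viewAfter_and_not_report, law_real_not_report,
    if_neg (Nat.not_even_two_mul_add_one j), probViewUp]

/-- The view has a periodic limit law: `x` and `y` are the limits of the probability of the view
`1` during the down and during the up periods. The recursion over one cycle is affine with factor
`(1 - reportUp) * (1 - reportDown)`; the factor is `1` only if nothing is ever reported, and then
the initial view persists. -/
lemma exists_tendsto_probViewUp : ∃ x y : ℝ,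
    Tendsto (fun j => π.probViewUp (2 * j)) atTop (𝓝 x) ∧
    Tendsto (fun j => π.probViewUp (2 * j + 1)) atTop (𝓝 y) ∧
    y = 1 - (1 - x) * (1 - π.reportUp) ∧ x = y * (1 - π.reportDown) ∧
    ((π.reportUp : ℝ) = 0 → (π.reportDown : ℝ) = 0 → x = π.initialUp) := by
  set U : ℝ := (π.reportUp : ℝ) with hU
  set V : ℝ := (π.reportDown : ℝ) with hV
  have hU0 : 0 ≤ U := π.reportUp.2.1
  have hU1 : U ≤ 1 := π.reportUp.2.2
  have hV0 : 0 ≤ V := π.reportDown.2.1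
  have hV1 : V ≤ 1 := π.reportDown.2.2
  have hrec : ∀ j, π.probViewUp (2 * (j + 1)) =
      (1 - (1 - π.probViewUp (2 * j)) * (1 - U)) * (1 - V) := fun j => by
    rw [probViewUp_two_mul_add_two, probViewUp_two_mul_add_one]
  suffices h : ∃ x : ℝ, Tendsto (fun j => π.probViewUp (2 * j)) atTop (𝓝 x) ∧
      (U = 0 → V = 0 → x = π.initialUp) by
    obtain ⟨x, hx, h0⟩ := h
    have hy : Tendsto (fun j => π.probViewUp (2 * j + 1)) atTop
        (𝓝 (1 - (1 - x) * (1 - U))) := by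
      simp only [probViewUp_two_mul_add_one]
      exact ((hx.const_sub 1).mul_const _).const_sub 1
    refine ⟨x, _, hx, hy, rfl, ?_, h0⟩
    refine tendsto_nhds_unique (hx.comp (tendsto_add_atTop_nat 1)) ?_
    simp only [Function.comp_def, probViewUp_two_mul_add_two]
    exact hy.mul_const _
  by_cases h : U = 0 ∧ V = 0
  · refine ⟨π.initialUp, ?_, fun _ _ => rfl⟩
    have hconst : ∀ j, π.probViewUp (2 * j) = π.initialUp := by
      intro j
      induction j with
      | zero => exact π.probViewUp_zero
      | succ j ih => rw [hrec, ih, h.1, h.2]; ring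
    simp only [hconst]
    exact tendsto_const_nhds
  · have hq0 : 0 ≤ (1 - U) * (1 - V) := mul_nonneg (by linarith) (by linarith)
    have hq1 : (1 - U) * (1 - V) < 1 := by
      rcases hU0.lt_or_eq with hU' | hU'
      · nlinarith
      · have hV' : 0 < V := lt_of_le_of_ne hV0 fun hV' => h ⟨hU'.symm, hV'.symm⟩
        nlinarith
    have hd : 1 - (1 - U) * (1 - V) ≠ 0 := by linarith
    obtain ⟨x, hx⟩ : ∃ x : ℝ, x = (1 - (1 - x) * (1 - U)) * (1 - V) := by
      refine ⟨U * (1 - V) / (1 - (1 - U) * (1 - V)), ?_⟩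
      linear_combination div_mul_cancel₀ (U * (1 - V)) hd
    refine ⟨x, ?_, fun h1 h2 => absurd ⟨h1, h2⟩ h⟩
    have hclosed : ∀ j, π.probViewUp (2 * j) =
        x + ((1 - U) * (1 - V)) ^ j * (π.initialUp - x) := by
      intro j
      induction j with
      | zero => simp [probViewUp_zero]
      | succ j ih =>
        rw [hrec, ih, pow_succ]
        linear_combination -hx
    simp only [hclosed]
    simpa using ((tendsto_pow_atTop_nhds_zero_of_lt_one hq0 hq1).mul_const
      (π.initialUp - x)).const_add x

lemma probAfter_true_false_even (j : ℕ) : π.probAfter true false (2 * j) = 0 := by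
  have : stateAfter (2 * j) = false := by simp [stateAfter]
  simp [probAfter, this]

lemma probAfter_true_false_odd (j : ℕ) :
    π.probAfter true false (2 * j + 1) = 1 - π.probViewUp (2 * j + 1) := by
  rw [← law_real_viewAfter_false]
  simp [probAfter, stateAfter]

lemma probAfter_false_true_even (j : ℕ) :
    π.probAfter false true (2 * j) = π.probViewUp (2 * j) := by
  simp [probAfter, probViewUp, stateAfter]

lemma probAfter_false_true_odd (j : ℕ) : π.probAfter false true (2 * j + 1) = 0 := by
  simp [probAfter, stateAfter]

end UpdatePolicy

end View

lemma neverUpdates_of_reportUp_eq_zero {π : UpdatePolicy} (h₁ : π.reportUp = 0)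
    (h₂ : π.reportDown = 0) : NeverUpdates π := by
  refine ae_all_iff.2 fun k => ?_
  have h : {c : Choices | ¬ c.2 k = false} = {c | c.2 k = true} := by
    ext c
    simp
  rw [ae_iff, h, π.law_report, h₁, h₂]
  simp

section Rate

variable {Ω : Type*} [MeasurableSpace Ω] {μ : Measure Ω} {Y Z : ℕ → Ω → ℝ} {τ θ : ℝ}

/-- The expected number of changes of either type in `[0, w]` (`r = 0` for the changes `0 → 1`,
`r = 1` for the changes `1 → 0`) is asymptotic to `w / (τ + θ)`: both changes of a cycle fall
between the ends of the previous and of the present cycle. -/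
lemma IsAlternatingProcess.tendsto_inv_mul_tsum_changeTime [IsProbabilityMeasure μ]
    (hX : IsAlternatingProcess μ Y Z τ θ) {r : ℕ} (hr : r ≤ 1) :
    Tendsto (fun w : ℝ => ENNReal.ofReal w⁻¹ * ∑' j, μ {ω | changeTime Y Z (2 * j + r) ω ≤ w})
      atTop (𝓝 (ENNReal.ofReal (τ + θ)⁻¹)) := by
  have hbetween : ∀ᵐ ω ∂μ, ∀ j,
      (∑ i ∈ Finset.range j, Y i ω) + ∑ i ∈ Finset.range j, Z i ω ≤
        changeTime Y Z (2 * j + r) ω ∧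
      changeTime Y Z (2 * j + r) ω ≤
        (∑ i ∈ Finset.range (j + 1), Y i ω) + ∑ i ∈ Finset.range (j + 1), Z i ω := by
    filter_upwards [hX.ae_pos] with ω hω j
    have hmono : Monotone fun n => ∑ i ∈ Finset.range n, periodLength Y Z i ω :=
      monotone_nat_of_le_succ fun k => by
        rw [Finset.sum_range_succ]
        linarith [periodLength_pos hω.1 hω.2 k]
    rw [← sum_periodLength_two_mul, ← sum_periodLength_two_mul]
    exact ⟨hmono (by omega), hmono (by omega)⟩
  refine tendsto_inv_mul_tsum_measure_le (Y := Y)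
    (V := fun j => changeTime Y Z (2 * j + r)) (add_pos hX.up_mean_pos hX.down_mean_pos)
    hX.measurable_down hX.down_pos hX.indep_down hX.identDistrib_down
    (fun j => hX.measurable_changeTime _) (fun j => ?_) ?_
  · filter_upwards [hbetween, hX.ae_pos] with ω h hpos
    have := Finset.sum_nonneg fun i (_ : i ∈ Finset.range j) => (hpos.2 i).le
    linarith [(h j).1]
  · filter_upwards [hbetween, hX.ae_tendsto_down, hX.ae_tendsto_up] with ω h hd hu
    have hlow := hd.add hu
    rw [add_comm θ] at hlow
    have hshift : Tendsto (fun n : ℕ => ((n + 1 : ℕ) : ℝ) / n) atTop (𝓝 1) := by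
      simpa using (tendsto_natCast_div_add_atTop (1 : ℝ)).inv₀ one_ne_zero
    have hupp := (hlow.comp (tendsto_add_atTop_nat 1)).mul hshift
    rw [mul_one] at hupp
    refine tendsto_of_tendsto_of_tendsto_of_le_of_le' hlow hupp (Eventually.of_forall fun j => ?_) ?_
    · rw [← add_div]
      exact div_le_div_of_nonneg_right (h j).1 (Nat.cast_nonneg j)
    · filter_upwards [eventually_gt_atTop 0] with j hj
      have h1 : ((j + 1 : ℕ) : ℝ) ≠ 0 := by positivity
      simp only [Function.comp]
      rw [← add_div, div_mul_div_cancel₀ h1]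
      exact div_le_div_of_nonneg_right (h j).2 (Nat.cast_nonneg j)

lemma lintegral_updateCount (hX : IsAlternatingProcess μ Y Z τ θ) (π : UpdatePolicy) (w : ℝ) :
    ∫⁻ p, ∑' k, {k : ℕ | changeTime Y Z k p.1 ≤ w ∧ p.2.2 k = true}.indicator
        (fun _ => (1 : ENNReal)) k ∂(jointLaw μ π) =
      (∑' j, μ {ω | changeTime Y Z (2 * j + 0) ω ≤ w}) * ENNReal.ofReal π.reportUp +
      (∑' j, μ {ω | changeTime Y Z (2 * j + 1) ω ≤ w}) * ENNReal.ofReal π.reportDown := by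
  have hmT : ∀ k, MeasurableSet {ω | changeTime Y Z k ω ≤ w} := fun k =>
    measurableSet_le (hX.measurable_changeTime k) measurable_const
  have hmR : ∀ k, MeasurableSet {c : Choices | c.2 k = true} := fun k =>
    measurableSet_eq_fun (by fun_prop) measurable_const
  have hind : ∀ k (p : Ω × Choices),
      {k : ℕ | changeTime Y Z k p.1 ≤ w ∧ p.2.2 k = true}.indicator (fun _ => (1 : ENNReal)) k =
        ({ω | changeTime Y Z k ω ≤ w} ×ˢ {c : Choices | c.2 k = true}).indicator
          (fun _ => (1 : ENNReal)) p := fun k p => by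
    simp [Set.indicator_apply]
  have hterm : ∀ k, ∫⁻ p, ({ω | changeTime Y Z k ω ≤ w} ×ˢ
      {c : Choices | c.2 k = true}).indicator (fun _ => (1 : ENNReal)) p ∂(jointLaw μ π) =
      μ {ω | changeTime Y Z k ω ≤ w} * π.law {c | c.2 k = true} := fun k => by
    rw [lintegral_indicator_const ((hmT k).prod (hmR k)), one_mul, jointLaw, Measure.prod_prod]
  simp only [hind]
  rw [lintegral_tsum fun k =>
    (measurable_const.indicator ((hmT k).prod (hmR k))).aemeasurable]
  simp only [hterm]
  rw [← tsum_even_add_odd ENNReal.summable ENNReal.summable, ← ENNReal.tsum_mul_right,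
    ← ENNReal.tsum_mul_right]
  have hber : ∀ p : unitInterval,
      bernoulliMeasure true false p {true} = ENNReal.ofReal p := fun p => by
    rw [← ofReal_measureReal]
    simp
  simp [UpdatePolicy.law_report, hber]

/-- Each type of change occurs once per cycle, hence at rate `1 / (τ + θ)`, and is reported with
its fixed probability. -/
lemma hasUpdateRate [IsProbabilityMeasure μ] (hX : IsAlternatingProcess μ Y Z τ θ)
    (π : UpdatePolicy) :
    HasUpdateRate μ Y Z π ((π.reportUp + π.reportDown) / (τ + θ)) := by
  have hstθ : 0 < τ + θ := add_pos hX.up_mean_pos hX.down_mean_pos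
  set f : ℝ → Ω × Choices → ENNReal := fun w p =>
    ∑' k, {k : ℕ | changeTime Y Z k p.1 ≤ w ∧ p.2.2 k = true}.indicator
      (fun _ => (1 : ENNReal)) k with hf
  have hmeas : ∀ w, Measurable (f w) := fun w => by
    refine Measurable.tsum fun k => ?_
    have h : MeasurableSet {p : Ω × Choices | changeTime Y Z k p.1 ≤ w ∧ p.2.2 k = true} :=
      (measurableSet_le ((hX.measurable_changeTime k).comp measurable_fst) measurable_const).inter
        (measurableSet_eq_fun (by fun_prop) measurable_const)
    exact measurable_const.indicator h (f := fun _ => (1 : ENNReal))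
  have hlim : Tendsto (fun w : ℝ => ENNReal.ofReal w⁻¹ * ∫⁻ p, f w p ∂(jointLaw μ π)) atTop
      (𝓝 (ENNReal.ofReal ((π.reportUp + π.reportDown) / (τ + θ)))) := by
    have h0 := ENNReal.Tendsto.mul_const (b := ENNReal.ofReal π.reportUp)
      (hX.tendsto_inv_mul_tsum_changeTime zero_le_one) (Or.inr ENNReal.ofReal_ne_top)
    have h1 := ENNReal.Tendsto.mul_const (b := ENNReal.ofReal π.reportDown)
      (hX.tendsto_inv_mul_tsum_changeTime le_rfl) (Or.inr ENNReal.ofReal_ne_top)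
    have h := h0.add h1
    rw [← mul_add, ← ENNReal.ofReal_add π.reportUp.2.1 π.reportDown.2.1,
      ← ENNReal.ofReal_mul (by positivity), inv_mul_eq_div] at h
    refine h.congr fun w => ?_
    rw [hf, lintegral_updateCount hX]
    ring
  have hfin := hlim.eventually_lt_const ENNReal.ofReal_lt_top
  have hreal := (ENNReal.tendsto_toReal ENNReal.ofReal_ne_top).comp hlim
  rw [ENNReal.toReal_ofReal (div_nonneg (add_nonneg π.reportUp.2.1 π.reportDown.2.1) hstθ.le)]
    at hreal
  refine hreal.congr' ?_
  filter_upwards [hfin, eventually_gt_atTop 0] with w hw hw0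
  have hne : ∫⁻ p, f w p ∂(jointLaw μ π) ≠ ⊤ := fun h => by
    rw [h, ENNReal.mul_top (by simpa using hw0)] at hw
    exact lt_irrefl _ hw
  have hcount : ∀ p, (updateCount Y Z w p : ℝ) = (f w p).toReal := fun p =>
    natCast_ncard_eq_toReal_tsum _
  simp only [hcount, Function.comp, ENNReal.toReal_mul]
  rw [integral_toReal (hmeas w).aemeasurable (ae_lt_top (hmeas w) hne),
    ENNReal.toReal_ofReal (by positivity)]

end Rate

/-! ### Minimization of the update rate -/

section Optimization

variable {Ω : Type*} [MeasurableSpace Ω] {μ : Measure Ω} [IsProbabilityMeasure μ]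
  {Y Z : ℕ → Ω → ℝ} {τ θ : ℝ}

/-- The distortions of a policy in terms of the periodic limit law of its view: `x` and `y` are the
long-run probabilities of the view `1` during the down and during the up periods. -/
lemma exists_hasLongRunProb (hX : IsAlternatingProcess μ Y Z τ θ) (π : UpdatePolicy) :
    ∃ x y : ℝ, HasLongRunProb μ Y Z π true false ((1 - y) * (τ / (τ + θ))) ∧
      HasLongRunProb μ Y Z π false true (x * (θ / (τ + θ))) ∧
      y = 1 - (1 - x) * (1 - π.reportUp) ∧ x = y * (1 - π.reportDown) ∧
      ((π.reportUp : ℝ) = 0 → (π.reportDown : ℝ) = 0 → x = π.initialUp) := by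
  obtain ⟨x, y, hx, hy, hxy⟩ := π.exists_tendsto_probViewUp
  refine ⟨x, y, ?_, ?_, hxy⟩
  · have h := hasLongRunProb_of_tendsto hX (π := π) (s := true) (v := false) (a := 0) (b := 1 - y)
      (by simp only [π.probAfter_true_false_even]; exact tendsto_const_nhds)
      (by simp only [π.probAfter_true_false_odd]; exact hy.const_sub 1)
    rwa [zero_mul, zero_add, mul_div_assoc, add_comm θ] at h
  · have h := hasLongRunProb_of_tendsto hX (π := π) (s := false) (v := true) (a := x) (b := 0)
      (by simp only [π.probAfter_false_true_even]; exact hx)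
      (by simp only [π.probAfter_false_true_odd]; exact tendsto_const_nhds)
    rwa [zero_mul, add_zero, mul_div_assoc, add_comm θ] at h

/-- The first two conditions follow from the third, which says that the tolerated conditional error
probabilities `ε₁ / (τ / (τ + θ))` and `ε₂ / (θ / (τ + θ))` sum to less than `1`.
In particular it forces `ε₂ < 1`, so that the quotient `ε₂ / (1 - ε₂)` is a genuine one. -/
lemma updatesNeeded_iff {ε₁ ε₂ : ℝ} (hτ : 0 < τ) (hθ : 0 < θ) (hε₁ : 0 ≤ ε₁) (hε₂ : 0 ≤ ε₂) :
    UpdatesNeeded τ θ ε₁ ε₂ ↔ ε₁ / (τ / (τ + θ)) + ε₂ / (θ / (τ + θ)) < 1 := by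
  have hsum : ε₁ / (τ / (τ + θ)) + ε₂ / (θ / (τ + θ)) =
      (ε₂ * τ + ε₁ * θ) / (τ * θ / (τ + θ)) := by
    field_simp
    ring
  have hp : 0 < τ * θ / (τ + θ) := by positivity
  rw [hsum, div_lt_one hp]
  refine ⟨fun h => h.2.2, fun h => ⟨?_, ?_, h⟩⟩
  all_goals rw [lt_div_iff₀ (by positivity)] at h
  · have h2 : ε₂ * (τ + θ) < θ := by
      by_contra hcon
      nlinarith [mul_nonneg hε₁ hθ.le, mul_nonneg (mul_nonneg hε₁ hθ.le) hτ.le,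
        mul_nonneg (mul_nonneg hε₁ hθ.le) hθ.le]
    have h3 : ε₂ < 1 := by
      by_contra hcon
      nlinarith
    rw [div_lt_div_iff₀ (by linarith) hτ]
    linarith
  · rcases hε₁.eq_or_lt with h0 | h0
    · exact Or.inl h0.symm
    · right
      have h2 : ε₁ * (τ + θ) < τ := by
        by_contra hcon
        nlinarith [mul_nonneg (mul_nonneg hε₂ hτ.le) hτ.le,
          mul_nonneg (mul_nonneg hε₂ hτ.le) hθ.le]
      rw [div_lt_div_iff₀ hτ h0]
      linarith

/-- The minimum rate, in terms of the tolerated conditional error probabilities. -/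
lemma minimum_rate_eq {ε₁ ε₂ : ℝ} (hτ : 0 < τ) (hθ : 0 < θ) :
    1 / (τ + θ) * (2 - ε₁ * (θ / τ) / (θ / (τ + θ) - ε₂) - ε₂ * (τ / θ) / (τ / (τ + θ) - ε₁)) =
      (2 - ε₁ / (τ / (τ + θ)) / (1 - ε₂ / (θ / (τ + θ))) -
        ε₂ / (θ / (τ + θ)) / (1 - ε₁ / (τ / (τ + θ)))) / (τ + θ) := by
  have h1 : ε₁ / (τ / (τ + θ)) / (1 - ε₂ / (θ / (τ + θ))) =
      ε₁ * (θ / τ) / (θ / (τ + θ) - ε₂) := by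
    have : 1 - ε₂ / (θ / (τ + θ)) = (θ / (τ + θ) - ε₂) / (θ / (τ + θ)) := by
      field_simp
    rw [this, div_div_eq_mul_div]
    congr 1
    field_simp
  have h2 : ε₂ / (θ / (τ + θ)) / (1 - ε₁ / (τ / (τ + θ))) =
      ε₂ * (τ / θ) / (τ / (τ + θ) - ε₁) := by
    have : 1 - ε₁ / (τ / (τ + θ)) = (τ / (τ + θ) - ε₁) / (τ / (τ + θ)) := by
      field_simp
    rw [this, div_div_eq_mul_div]
    congr 1
    field_simp
  rw [h1, h2, one_div_mul_eq_div]

/-- A policy that meets the criterion has conditional error probabilities `1 - y ≤ p` and `x ≤ q`.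
The balance of its view over a cycle makes the probabilities of not reporting
`(1 - y) / (1 - x) ≤ p / (1 - q)` and `x / y ≤ q / (1 - p)`. -/
lemma le_reportUp_add_reportDown {x y U V p q : ℝ} (hV : V ≤ 1)
    (hp : 1 - y ≤ p) (hq : x ≤ q) (hp0 : 0 ≤ p) (hq0 : 0 ≤ q) (hpq : p + q < 1)
    (hy : y = 1 - (1 - x) * (1 - U)) (hx : x = y * (1 - V)) :
    2 - p / (1 - q) - q / (1 - p) ≤ U + V := by
  have hy0 : 0 < y := by linarith
  have hx0 : 0 ≤ x := hx ▸ mul_nonneg hy0.le (by linarith)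
  have h1 : 1 - U = (1 - y) / (1 - x) := by
    rw [eq_div_iff (by linarith)]
    linarith
  have h2 : 1 - V = x / y := by
    rw [eq_div_iff hy0.ne']
    linarith
  have h3 : (1 - y) / (1 - x) ≤ p / (1 - q) := by
    gcongr
    linarith
  have h4 : x / y ≤ q / (1 - p) := by
    gcongr <;> linarith
  linarith

/-- Where the tolerated conditional error probabilities `p` and `q` sum to less than `1`, the
policy with `1 - reportUp = p / (1 - q)` and `1 - reportDown = q / (1 - p)` has exactly these
conditional error probabilities. -/
lemma exists_policy_eq (hX : IsAlternatingProcess μ Y Z τ θ) {p q : ℝ} (hp0 : 0 ≤ p) (hq0 : 0 ≤ q)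
    (hpq : p + q < 1) :
    ∃ π : UpdatePolicy, HasLongRunProb μ Y Z π true false (p * (τ / (τ + θ))) ∧
      HasLongRunProb μ Y Z π false true (q * (θ / (τ + θ))) ∧
      (π.reportUp : ℝ) = 1 - p / (1 - q) ∧ (π.reportDown : ℝ) = 1 - q / (1 - p) := by
  have hp1 : 0 < 1 - p := by linarith
  have hq1 : 0 < 1 - q := by linarith
  have hU0 : 0 ≤ p / (1 - q) := by positivity
  have hU1 : p / (1 - q) < 1 := by
    rw [div_lt_one hq1]
    linarith
  have hV0 : 0 ≤ q / (1 - p) := by positivity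
  have hV1 : q / (1 - p) < 1 := by
    rw [div_lt_one hp1]
    linarith
  let π : UpdatePolicy :=
    { reportUp := ⟨1 - p / (1 - q), by linarith, by linarith⟩
      reportDown := ⟨1 - q / (1 - p), by linarith, by linarith⟩
      initialUp := 0 }
  obtain ⟨x, y, h1, h2, hy, hx, -⟩ := exists_hasLongRunProb hX π
  have hU : (π.reportUp : ℝ) = 1 - p / (1 - q) := rfl
  have hV : (π.reportDown : ℝ) = 1 - q / (1 - p) := rfl
  rw [hU, sub_sub_cancel] at hy
  rw [hV, sub_sub_cancel] at hx
  -- `(q, 1 - p)` solves the same balance equations, whose solution is unique.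
  have hxq : x = q := by
    have hlt : p / (1 - q) * (q / (1 - p)) < 1 := mul_lt_one_of_nonneg_of_lt_one_left hU0 hU1 hV1.le
    have heq : (x - q) * (1 - p / (1 - q) * (q / (1 - p))) = 0 := by
      rw [hy] at hx
      have hq' : q = (1 - (1 - q) * (p / (1 - q))) * (q / (1 - p)) := by
        field_simp
      linear_combination hx - hq'
    rcases mul_eq_zero.1 heq with h | h <;> linarith
  have hyp : 1 - y = p := by
    rw [hy, hxq]
    field_simp
    ring
  rw [hyp] at h1
  rw [hxq] at h2
  exact ⟨π, h1, h2, hU, hV⟩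

/-- Where the tolerated conditional error probabilities sum to at least `1`, a constant view drawn
at random splits the error between the two states as required. -/
lemma exists_neverUpdates (hX : IsAlternatingProcess μ Y Z τ θ) {p q : ℝ} (hp0 : 0 ≤ p)
    (hq0 : 0 ≤ q) (hpq : 1 ≤ p + q) :
    ∃ π : UpdatePolicy, NeverUpdates π ∧
      MeetsCriterion μ Y Z π (p * (τ / (τ + θ))) (q * (θ / (τ + θ))) := by
  have hτ := hX.up_mean_pos
  have hθ := hX.down_mean_pos
  let π : UpdatePolicy :=
    { reportUp := 0
      reportDown := 0
      initialUp := ⟨min 1 q, le_min zero_le_one hq0, min_le_left _ _⟩ }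
  refine ⟨π, neverUpdates_of_reportUp_eq_zero rfl rfl, ?_⟩
  obtain ⟨x, y, h1, h2, hy, hx, hx0⟩ := exists_hasLongRunProb hX π
  have hxq : x = min 1 q := hx0 rfl rfl
  have hyx : y = x := by
    have hV : (π.reportDown : ℝ) = 0 := rfl
    rw [hV] at hx
    linarith
  refine ⟨_, _, h1, h2, ?_, ?_⟩
  · gcongr
    rw [hyx, hxq]
    rcases min_choice 1 q with h | h <;> rw [h] <;> linarith
  · gcongr
    rw [hxq]
    exact min_le_right _ _

end Optimization

theorem lemma1 {Ω : Type*} [MeasurableSpace Ω] (μ : Measure Ω) [IsProbabilityMeasure μ]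
    (Y Z : ℕ → Ω → ℝ) (τ θ ε₁ ε₂ : ℝ)
    (hX : IsAlternatingProcess μ Y Z τ θ) (hε₁ : 0 ≤ ε₁) (hε₂ : 0 ≤ ε₂) :
    (∀ π : UpdatePolicy, ∃ D₁ D₂ R : ℝ,
      HasLongRunProb μ Y Z π true false D₁ ∧ HasLongRunProb μ Y Z π false true D₂ ∧
        HasUpdateRate μ Y Z π R) ∧
    (UpdatesNeeded τ θ ε₁ ε₂ →
      IsLeast {R : ℝ | ∃ π : UpdatePolicy, MeetsCriterion μ Y Z π ε₁ ε₂ ∧ HasUpdateRate μ Y Z π R}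
        (1 / (τ + θ) *
          (2 - ε₁ * (θ / τ) / (θ / (τ + θ) - ε₂) - ε₂ * (τ / θ) / (τ / (τ + θ) - ε₁)))) ∧
    (¬ UpdatesNeeded τ θ ε₁ ε₂ →
      ∃ π : UpdatePolicy, NeverUpdates π ∧ MeetsCriterion μ Y Z π ε₁ ε₂) := by
  have hτ := hX.up_mean_pos
  have hθ := hX.down_mean_pos
  have ha : 0 < θ / (τ + θ) := by positivity
  have hb : 0 < τ / (τ + θ) := by positivity
  have hp0 : 0 ≤ ε₁ / (τ / (τ + θ)) := by positivity
  have hq0 : 0 ≤ ε₂ / (θ / (τ + θ)) := by positivity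
  rw [updatesNeeded_iff hτ hθ hε₁ hε₂, minimum_rate_eq hτ hθ]
  refine ⟨fun π => ?_, fun h => ⟨?_, ?_⟩, fun h => ?_⟩
  · obtain ⟨x, y, h1, h2, -⟩ := exists_hasLongRunProb hX π
    exact ⟨_, _, _, h1, h2, hasUpdateRate hX π⟩
  · obtain ⟨π, h1, h2, hU, hV⟩ := exists_policy_eq hX hp0 hq0 h
    rw [div_mul_cancel₀ _ hb.ne'] at h1
    rw [div_mul_cancel₀ _ ha.ne'] at h2
    refine ⟨π, ⟨_, _, h1, h2, le_rfl, le_rfl⟩, ?_⟩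
    convert hasUpdateRate hX π using 2
    rw [hU, hV]
    ring
  · rintro R ⟨π, ⟨D₁, D₂, hD₁, hD₂, hle₁, hle₂⟩, hR⟩
    obtain ⟨x, y, h1, h2, hy, hx, -⟩ := exists_hasLongRunProb hX π
    rw [tendsto_nhds_unique hR (hasUpdateRate hX π)]
    rw [tendsto_nhds_unique hD₁ h1, ← le_div_iff₀ hb] at hle₁
    rw [tendsto_nhds_unique hD₂ h2, ← le_div_iff₀ ha] at hle₂
    gcongr
    exact le_reportUp_add_reportDown π.reportDown.2.2 hle₁ hle₂ hp0 hq0 h hy hx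
  · obtain ⟨π, hπ, hc⟩ := exists_neverUpdates (μ := μ) hX hp0 hq0 (not_lt.1 h)
    rw [div_mul_cancel₀ _ hb.ne', div_mul_cancel₀ _ ha.ne'] at hc
    exact ⟨π, hπ, hc⟩
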